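/- Let $\mathcal X$ be a Polish space with its Borel $\sigma$-algebra and let $\mathcal Y$ be a measurable space (for instance a topological space with its Borel $\sigma$-algebra). Let $\gamma\mapsto\mu_\gamma$ be a measurable family of Borel probability measures on $\mathcal X$ indexed by $\gamma\in\mathcal Y$, i.e. $\gamma\mapsto\mu_\gamma(A)$ is measurable for every Borel set $A\subseteq\mathcal X$. Let $c:\mathcal X\times\mathcal X\to[0,\infty)$ be lower semicontinuous. For Borel probability measures $\mu,\nu$ on $\mathcal X$ let $\mathcal C(\mu,\nu)$ be the set of Borel probability measures on $\mathcal X\times\mathcal X$ with first marginal $\mu$ and second marginal $\nu$, and let \[ \mathcal W_c(\mu,\nu)=\inf_{\xi\in\mathcal C(\mu,\nu)}\int_{\mathcal X\times\mathcal X}c(u,v)\,\xi(du,dv)\in[0,\infty]. \] Then the function $(\gamma,\gamma')\mapsto\mathcal W_c(\mu_\gamma,\mu_{\gamma'})$ from $\mathcal Y\times\mathcal Y$ (with the product $\sigma$-algebra) to $[0,\infty]$ is measurable. Moreover, there is a measurable selection of optimal couplings: a family $(\xi_{\gamma,\gamma'})_{\gamma,\gamma'\in\mathcal Y}$ with $\xi_{\gamma,\gamma'}\in\mathcal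 C(\mu_\gamma,\mu_{\gamma'})$ and \[ \int_{\mathcal X\times\mathcal X}c(u,v)\,\xi_{\gamma,\gamma'}(du,dv)=\mathcal W_c(\mu_\gamma,\mu_{\gamma'}) \] for all $\gamma,\gamma'\in\mathcal Y$, such that $(\gamma,\gamma')\mapsto\xi_{\gamma,\gamma'}(B)$ is measurable on $\mathcal Y\times\mathcal Y$ for every Borel set $B\subseteq\mathcal X\times\mathcal X$. -/

import Mathlib

open MeasureTheory
open scoped NNReal ENNReal

/-- The set `𝒞(μ, ν)` of couplings of two probability measures on `X`: the probability measures on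
`X × X` with first marginal `μ` and second marginal `ν`. -/
def couplings {X : Type*} [MeasurableSpace X] (μ ν : ProbabilityMeasure X) :
    Set (ProbabilityMeasure (X × X)) :=
  {ξ | (ξ : Measure (X × X)).fst = μ ∧ (ξ : Measure (X × X)).snd = ν}

/-- The integral of a nonnegative cost against a transport plan, with value in `[0, ∞]`. -/
noncomputable def planCost {X : Type*} [MeasurableSpace X] (c : X × X → ℝ≥0)
    (ξ : ProbabilityMeasure (X × X)) : ℝ≥0∞ :=
  ∫⁻ z, (c z : ℝ≥0∞) ∂(ξ : Measure (X × X))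

/-- The optimal transport cost `𝒲_c(μ, ν)`, the infimum over all couplings of the integral of the
cost, with value in `[0, ∞]`. -/
noncomputable def transportCost {X : Type*} [MeasurableSpace X] (c : X × X → ℝ≥0)
    (μ ν : ProbabilityMeasure X) : ℝ≥0∞ :=
  ⨅ ξ ∈ couplings μ ν, planCost c ξ

/-!
Couplings on a noncompact space are moved to a compact one: an embedding of `X` into the Hilbert
cube `K` has Borel range, so pushing forward identifies the couplings of `μ` and `ν` with those of
their images, and the cost extends to a lower semicontinuous function on `K × K`. There the
probability measures form a compact metrizable space, on which the total cost is lower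
semicontinuous and the couplings are the fibres of the continuous map to the marginals.

The compact-valued family of couplings thus hits each closed set on a measurable set of parameters,
and this property passes to the family of minimizers of a lower semicontinuous function, whose
minimum value is moreover measurable. Applied to the cost, this gives the optimal couplings; then
applied in turn to countably many coordinates which separate points, it leaves a single optimal
coupling, whose coordinates are successive minimum values and therefore measurable.
-/

open Set Filter Topology TopologicalSpace

theorem exists_isEmbedding_hilbertCube (X : Type*) [TopologicalSpace X] [MetrizableSpace X]
    [SeparableSpace X] : ∃ i : X → ℕ → unitInterval, IsEmbedding i := by
  let := metrizableSpaceMetric X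
  exact Metric.PiNatEmbed.exists_embedding_to_hilbert_cube

section ClosedFamilies

variable {Ω S β : Type*}

/-- The set of minimizers of `J` on `A`. -/
def argminOn [Preorder β] (J : S → β) (A : Set S) : Set S :=
  {x ∈ A | IsMinOn J A x}

/-- The set left of `A` after minimizing the first `n` functions of the sequence `g` in turn, each
one on the set of minimizers of its predecessors. It is used to select a point of `A`. -/
def lexArgminOn [Preorder β] (g : ℕ → S → β) (A : Set S) : ℕ → Set S
  | 0 => A
  | n + 1 => argminOn (g n) (lexArgminOn g A n)

/-- Measurability of a closed-set-valued map (a measurable multifunction): the values may be empty,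
and each closed set is hit on a measurable set of parameters. -/
structure IsMeasurableClosedFamily [MeasurableSpace Ω] [TopologicalSpace S] (F : Ω → Set S) :
    Prop where
  isClosed : ∀ p, IsClosed (F p)
  measurableSet_hit : ∀ C, IsClosed C → MeasurableSet {p | (F p ∩ C).Nonempty}

theorem argminOn_eq_inter [CompleteLattice β] (J : S → β) (A : Set S) :
    argminOn J A = A ∩ J ⁻¹' Iic (⨅ y ∈ A, J y) := by
  ext x
  simp [argminOn, isMinOn_iff]

theorem eq_iInf_of_mem_argminOn [CompleteLattice β] {J : S → β} {A : Set S} {x : S}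
    (hx : x ∈ argminOn J A) : J x = ⨅ y ∈ A, J y :=
  le_antisymm (le_iInf₂ fun _ hy => hx.2 hy) (iInf₂_le x hx.1)

variable [TopologicalSpace S]

theorem IsMeasurableClosedFamily.inter_isClosed [MeasurableSpace Ω] {F : Ω → Set S}
    (hF : IsMeasurableClosedFamily F) {C : Set S} (hC : IsClosed C) :
    IsMeasurableClosedFamily fun p => F p ∩ C where
  isClosed p := (hF.isClosed p).inter hC
  measurableSet_hit D hD := by
    simpa only [inter_assoc] using hF.measurableSet_hit (C ∩ D) (hC.inter hD)

variable [CompactSpace S]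

theorem argminOn_nonempty [LinearOrder β] {J : S → β} (hJ : LowerSemicontinuous J) {A : Set S}
    (hA : IsClosed A) (hne : A.Nonempty) : (argminOn J A).Nonempty :=
  (hJ.lowerSemicontinuousOn A).exists_isMinOn hne hA.isCompact

variable [CompleteLinearOrder β]

namespace IsMeasurableClosedFamily

variable [MeasurableSpace Ω] {F : Ω → Set S}

theorem preimage_singleton {T : Type*} [TopologicalSpace T] [T2Space T] [MeasurableSpace T]
    [OpensMeasurableSpace T] {φ : S → T} (hφ : Continuous φ) {t : Ω → T} (ht : Measurable t) :
    IsMeasurableClosedFamily fun p => φ ⁻¹' {t p} where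
  isClosed p := isClosed_singleton.preimage hφ
  measurableSet_hit C hC := by
    convert ht (hC.isCompact.image hφ).isClosed.measurableSet using 1
    ext p
    simp [Set.Nonempty, and_comm]

variable [TopologicalSpace β] [OrderTopology β] [SecondCountableTopology β] [MeasurableSpace β]
  [BorelSpace β] {J : S → β}

theorem measurable_iInf (hF : IsMeasurableClosedFamily F) (hJ : LowerSemicontinuous J) :
    Measurable fun p => ⨅ x ∈ F p, J x := by
  refine measurable_of_Iic fun a => ?_
  rcases eq_or_ne a ⊤ with rfl | ha
  · simp
  convert hF.measurableSet_hit (J ⁻¹' Iic a) (hJ.isClosed_preimage a) using 1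
  ext p
  refine ⟨fun hp => ?_, fun ⟨x, hxF, hxa⟩ => (iInf₂_le x hxF).trans hxa⟩
  have hne : (F p).Nonempty := by
    by_contra! hempty
    exact ha (top_le_iff.1 (by simpa [hempty] using hp))
  obtain ⟨x, hx⟩ := argminOn_nonempty hJ (hF.isClosed p) hne
  exact ⟨x, hx.1, (eq_iInf_of_mem_argminOn hx).trans_le hp⟩

/- A closed set `C` contains a minimizer of `J` on `F p` if and only if it meets `F p` and the
minimum of `J` on `F p ∩ C` does not exceed that on `F p`. -/
theorem argminOn (hF : IsMeasurableClosedFamily F) (hJ : LowerSemicontinuous J) :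
    IsMeasurableClosedFamily fun p => argminOn J (F p) where
  isClosed p := by
    rw [argminOn_eq_inter]
    exact (hF.isClosed p).inter (hJ.isClosed_preimage _)
  measurableSet_hit C hC := by
    have hFC := hF.inter_isClosed hC
    convert (hF.measurableSet_hit C hC).inter
      (measurableSet_le (hFC.measurable_iInf hJ) (hF.measurable_iInf hJ)) using 1
    ext p
    constructor
    · rintro ⟨x, hx, hxC⟩
      exact ⟨⟨x, hx.1, hxC⟩, (iInf₂_le x ⟨hx.1, hxC⟩).trans_eq (eq_iInf_of_mem_argminOn hx)⟩
    · rintro ⟨hne, hle⟩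
      obtain ⟨x, hx⟩ := argminOn_nonempty hJ (hFC.isClosed p) hne
      refine ⟨x, ?_, hx.1.2⟩
      rw [argminOn_eq_inter]
      exact ⟨hx.1.1, (eq_iInf_of_mem_argminOn hx).trans_le hle⟩

theorem lexArgminOn (hF : IsMeasurableClosedFamily F) {g : ℕ → S → β}
    (hg : ∀ n, LowerSemicontinuous (g n)) (n : ℕ) :
    IsMeasurableClosedFamily fun p => lexArgminOn g (F p) n := by
  induction n with
  | zero => exact hF
  | succ n ih => exact ih.argminOn (hg n)

end IsMeasurableClosedFamily

theorem lexArgminOn_isClosed_nonempty {g : ℕ → S → β} (hg : ∀ n, LowerSemicontinuous (g n))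
    {A : Set S} (hA : IsClosed A) (hne : A.Nonempty) (n : ℕ) :
    IsClosed (lexArgminOn g A n) ∧ (lexArgminOn g A n).Nonempty := by
  induction n with
  | zero => exact ⟨hA, hne⟩
  | succ n ih =>
    refine ⟨?_, argminOn_nonempty (hg n) ih.1 ih.2⟩
    rw [lexArgminOn, argminOn_eq_inter]
    exact ih.1.inter ((hg n).isClosed_preimage _)

theorem iInter_lexArgminOn_nonempty {g : ℕ → S → β} (hg : ∀ n, LowerSemicontinuous (g n))
    {A : Set S} (hA : IsClosed A) (hne : A.Nonempty) : (⋂ n, lexArgminOn g A n).Nonempty :=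
  have h := lexArgminOn_isClosed_nonempty hg hA hne
  IsCompact.nonempty_iInter_of_sequence_nonempty_isCompact_isClosed _ (fun _ => sep_subset _ _)
    (fun n => (h n).2) hA.isCompact fun n => (h n).1

theorem IsMeasurableClosedFamily.exists_measurable_selection [MetrizableSpace S]
    [MeasurableSpace S] [BorelSpace S] [MeasurableSpace Ω] {F : Ω → Set S}
    (hF : IsMeasurableClosedFamily F) (hne : ∀ p, (F p).Nonempty) :
    ∃ s : Ω → S, Measurable s ∧ ∀ p, s p ∈ F p := by
  obtain ⟨e, he⟩ := exists_isEmbedding_hilbertCube S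
  let g : ℕ → S → unitInterval := fun n x => e x n
  have hg : ∀ n, LowerSemicontinuous (g n) := fun n =>
    ((continuous_apply n).comp he.continuous).lowerSemicontinuous
  choose s hs using fun p => iInter_lexArgminOn_nonempty hg (hF.isClosed p) (hne p)
  have hs_lex := fun p => mem_iInter.1 (hs p)
  have he_meas : MeasurableEmbedding e :=
    (he.continuous.isClosedEmbedding he.injective).measurableEmbedding
  refine ⟨s, he_meas.measurable_comp_iff.1 (measurable_pi_iff.2 fun n => ?_), fun p => hs_lex p 0⟩
  convert (hF.lexArgminOn hg n).measurable_iInf (hg n) using 2 with p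
  exact eq_iInf_of_mem_argminOn (hs_lex p (n + 1))

end ClosedFamilies

section LowerSemicontinuity

theorem lowerSemicontinuous_liminf_comap_nhds {X E β : Type*} [TopologicalSpace E]
    [CompleteLinearOrder β] (j : X → E) (f : X → β) :
    LowerSemicontinuous fun z => liminf f (comap j (𝓝 z)) := by
  intro z b hb
  change b < liminf f (comap j (𝓝 z)) at hb
  change ∀ᶠ w in 𝓝 z, b < liminf f (comap j (𝓝 w))
  rw [((nhds_basis_opens z).comap j).liminf_eq_iSup_iInf] at hb
  obtain ⟨U, ⟨hzU, hU⟩, hbU⟩ : ∃ U, (z ∈ U ∧ IsOpen U) ∧ b < ⨅ x ∈ j ⁻¹' U, f x := by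
    simpa only [lt_iSup_iff, exists_prop] using hb
  filter_upwards [hU.mem_nhds hzU] with w hwU
  exact hbU.trans_le (le_liminf_of_le (by isBoundedDefault)
    (mem_of_superset (preimage_mem_comap (hU.mem_nhds hwU)) fun x hx => iInf₂_le x hx))

theorem exists_lowerSemicontinuous_extension {X E β : Type*} [TopologicalSpace X]
    [TopologicalSpace E] [CompleteLinearOrder β] {j : X → E} (hj : IsInducing j) {f : X → β}
    (hf : LowerSemicontinuous f) : ∃ f' : E → β, LowerSemicontinuous f' ∧ ∀ x, f' (j x) = f x := by
  refine ⟨_, lowerSemicontinuous_liminf_comap_nhds j f, fun x => ?_⟩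
  rw [← hj.nhds_eq_comap]
  have hfreq : ∃ᶠ y in 𝓝 x, f y ≤ f x :=
    Frequently.filter_mono (frequently_pure.2 (le_refl (f x))) (pure_le_nhds x)
  exact le_antisymm (liminf_le_of_frequently_le hfreq) (lowerSemicontinuous_iff_le_liminf.1 hf x)

variable {E : Type*} [TopologicalSpace E]

theorem exists_monotone_continuous_iSup_eq [PseudoMetrizableSpace E] {f : E → ℝ≥0∞}
    (hf : LowerSemicontinuous f) :
    ∃ g : ℕ → E → ℝ≥0∞, Monotone g ∧ (∀ n, Continuous (g n)) ∧ ∀ x, ⨆ n, g n x = f x := by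
  let := pseudoMetrizableSpacePseudoMetric E
  -- the inf-convolutions of `f` with the multiples of the distance
  let g : ℕ → E → ℝ≥0∞ := fun n x => ⨅ y, f y + n * edist x y
  have hg_lip : ∀ n x z, g n x ≤ g n z + n * edist x z := fun n x z => by
    simp only [g, ENNReal.iInf_add]
    refine iInf_mono fun y => ?_
    rw [add_assoc, ← mul_add]
    gcongr
    rw [add_comm]
    exact edist_triangle x z y
  refine ⟨g, fun m n hmn x => iInf_mono fun y => by gcongr,
    fun n => continuous_of_le_add_edist n (ENNReal.natCast_ne_top n) (hg_lip n),
    fun x => le_antisymm (iSup_le fun n => ?_) (le_of_forall_lt_imp_le_of_dense fun a ha => ?_)⟩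
  · simpa using iInf_le (fun y => f y + n * edist x y) x
  · obtain ⟨ε, hε, hball⟩ := EMetric.mem_nhds_iff.1 (hf x a ha)
    obtain ⟨n, hn⟩ := ENNReal.exists_nat_mul_gt hε.ne' ha.ne_top
    refine le_iSup_of_le n (le_iInf fun y => ?_)
    rcases lt_or_ge (edist y x) ε with hy | hy
    · exact (hball hy).le.trans le_self_add
    · calc
        a ≤ n * ε := hn.le
        _ ≤ n * edist x y := by rw [edist_comm]; gcongr
        _ ≤ f y + n * edist x y := le_add_self

variable [MeasurableSpace E] [OpensMeasurableSpace E]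

theorem continuous_lintegral_of_le {f : E → ℝ≥0∞} (hf : Continuous f) {C : ℝ≥0}
    (hC : ∀ x, f x ≤ C) : Continuous fun ξ : ProbabilityMeasure E => ∫⁻ x, f x ∂ξ := by
  have hf_top : ∀ x, f x ≠ ⊤ := fun x => ne_top_of_le_ne_top ENNReal.coe_ne_top (hC x)
  have hf_Icc : ∀ x, ((f x).toNNReal : ℝ) ∈ Icc (0 : ℝ) C := fun x =>
    ⟨NNReal.coe_nonneg _, ENNReal.toReal_le_coe_of_le_coe (hC x)⟩
  let h : BoundedContinuousFunction E ℝ≥0 := .mkOfBound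
    ⟨fun x => (f x).toNNReal, ENNReal.continuousOn_toNNReal.comp_continuous hf hf_top⟩ C
    fun x y => (Real.dist_le_of_mem_Icc (hf_Icc x) (hf_Icc y)).trans_eq (sub_zero _)
  have h_coe : ∀ x, (h x : ℝ≥0∞) = f x := fun x => ENNReal.coe_toNNReal (hf_top x)
  simpa only [h_coe] using
    ProbabilityMeasure.continuous_lintegral_boundedContinuousFunction h

theorem lowerSemicontinuous_lintegral [PseudoMetrizableSpace E] {f : E → ℝ≥0∞}
    (hf : LowerSemicontinuous f) :
    LowerSemicontinuous fun ξ : ProbabilityMeasure E => ∫⁻ x, f x ∂ξ := by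
  obtain ⟨g, hg_mono, hg_cont, hg_sup⟩ := exists_monotone_continuous_iSup_eq hf
  have hcast_mono : Monotone fun n : ℕ => (n : ℝ≥0∞) := Nat.mono_cast
  have hf_eq : ∀ x, f x = ⨆ n : ℕ, g n x ⊓ n := fun x => by
    rw [iSup_inf_of_monotone (fun m n hmn => hg_mono hmn x) hcast_mono, hg_sup,
      ENNReal.iSup_natCast, inf_top_eq]
  have hcont : ∀ n : ℕ, Continuous fun x => g n x ⊓ (n : ℝ≥0∞) := fun n =>
    (hg_cont n).inf continuous_const
  have hint_eq (ξ : ProbabilityMeasure E) : ∫⁻ x, f x ∂ξ = ⨆ n : ℕ, ∫⁻ x, g n x ⊓ n ∂ξ := by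
    simp only [hf_eq]
    exact lintegral_iSup (fun n => (hcont n).measurable)
      fun m n hmn x => inf_le_inf (hg_mono hmn x) (hcast_mono hmn)
  simp only [hint_eq]
  exact lowerSemicontinuous_iSup fun n =>
    (continuous_lintegral_of_le (hcont n) (C := n) fun x => by simp).lowerSemicontinuous

end LowerSemicontinuity

section BorelStructure

variable {E : Type*} [TopologicalSpace E] [MeasurableSpace E]

theorem probabilityMeasure_topology_eq_generateFrom_lintegral [OpensMeasurableSpace E] :
    (inferInstance : TopologicalSpace (ProbabilityMeasure E)) =
      generateFrom {U | ∃ (f : BoundedContinuousFunction E ℝ≥0) (V : Set ℝ≥0∞), IsOpen V ∧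
        (fun ξ : ProbabilityMeasure E => ∫⁻ x, f x ∂ξ) ⁻¹' V = U} := by
  refine le_antisymm (le_generateFrom ?_) (continuous_id_iff_le.1 ?_)
  · rintro _ ⟨f, V, hV, rfl⟩
    exact hV.preimage (ProbabilityMeasure.continuous_lintegral_boundedContinuousFunction f)
  · refine (@ProbabilityMeasure.continuous_iff_forall_continuous_lintegral _ _ _ _ _
      (generateFrom _) id).2 fun f => ?_
    exact continuous_def.2 fun V hV => isOpen_generateFrom_of_mem ⟨f, V, hV, rfl⟩

variable [BorelSpace E]

theorem measurable_toMeasure_of_continuous [HasOuterApproxClosed E] {Ω : Type*}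
    [TopologicalSpace Ω] [MeasurableSpace Ω] [OpensMeasurableSpace Ω]
    {ξ : Ω → ProbabilityMeasure E} (hξ : Continuous ξ) : Measurable fun p => (ξ p : Measure E) := by
  refine Measurable.measure_of_isPiSystem_of_isProbabilityMeasure
    (borel_eq_generateFrom_isClosed (α := E) ▸ BorelSpace.measurable_eq) isPiSystem_isClosed
    fun C hC => ?_
  refine measurable_of_tendsto_metrizable (fun n => Continuous.measurable ?_)
    (tendsto_pi_nhds.2 fun p => HasOuterApproxClosed.tendsto_lintegral_apprSeq hC (ξ p))
  exact ProbabilityMeasure.continuous_iff_forall_continuous_lintegral.1 hξ (hC.apprSeq n)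

instance borelSpace_probabilityMeasure [HasOuterApproxClosed E]
    [SecondCountableTopology (ProbabilityMeasure E)] : BorelSpace (ProbabilityMeasure E) where
  measurable_eq := by
    refine le_antisymm (Measurable.comap_le ?_) ?_
    · exact @measurable_toMeasure_of_continuous E _ _ _ _ _ _ (borel _)
        (@OpensMeasurableSpace.mk _ _ (borel _) le_rfl) id continuous_id
    · rw [borel_eq_generateFrom_of_subbasis probabilityMeasure_topology_eq_generateFrom_lintegral]
      refine MeasurableSpace.generateFrom_le ?_
      rintro _ ⟨f, V, hV, rfl⟩
      have hf : Measurable fun x => (f x : ℝ≥0∞) := f.continuous.measurable.coe_nnreal_ennreal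
      exact ((Measure.measurable_lintegral hf).comp measurable_subtype_coe) hV.measurableSet

end BorelStructure

section PushForward

variable {X K Ω : Type*} [MeasurableSpace X] [MeasurableSpace K] [MeasurableSpace Ω]

theorem measurable_measure_map_iff {j : X → K} (hj : MeasurableEmbedding j)
    {m : Ω → Measure X} : (Measurable fun p => (m p).map j) ↔ Measurable m := by
  refine ⟨fun h => Measure.measurable_of_measurable_coe _ fun B hB => ?_,
    (Measure.measurable_map j hj.measurable).comp⟩
  convert (Measure.measurable_coe (hj.measurableSet_image.2 hB)).comp h using 2 with p
  simp [hj.map_apply, preimage_image_eq B hj.injective]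

theorem measurable_probabilityMeasure_map_iff {j : X → K} (hj : MeasurableEmbedding j)
    {m : Ω → ProbabilityMeasure X} :
    (Measurable fun p => (m p).map hj.measurable.aemeasurable) ↔ Measurable m := by
  have h := measurable_measure_map_iff hj (m := fun p => (m p : Measure X))
  exact ⟨fun hm => (h.1 (measurable_subtype_coe.comp hm)).subtype_mk,
    fun hm => (h.2 (measurable_subtype_coe.comp hm)).subtype_mk⟩

theorem exists_map_eq_of_ae_mem_range {j : X → K} (hj : MeasurableEmbedding j)
    (ξ : ProbabilityMeasure K) (h : ∀ᵐ z ∂(ξ : Measure K), z ∈ range j) :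
    ∃ η : ProbabilityMeasure X, η.map hj.measurable.aemeasurable = ξ := by
  have hmap : ((ξ : Measure K).comap j).map j = ξ := by
    rw [hj.map_comap, Measure.restrict_eq_self_of_ae_mem h]
  have : IsProbabilityMeasure (((ξ : Measure K).comap j).map j) := by rw [hmap]; infer_instance
  have hprob := Measure.isProbabilityMeasure_of_map (μ := (ξ : Measure K).comap j) j
  exact ⟨⟨_, hprob⟩, ProbabilityMeasure.toMeasure_injective hmap⟩

end PushForward

section Couplings

variable {X : Type*} [MeasurableSpace X]

/-- The pair of marginals of a probability measure on a product: `couplings μ ν` is its fibre over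
`(μ, ν)`. -/
noncomputable def marginals (ξ : ProbabilityMeasure (X × X)) :
    ProbabilityMeasure X × ProbabilityMeasure X :=
  (ξ.map measurable_fst.aemeasurable, ξ.map measurable_snd.aemeasurable)

theorem couplings_eq_preimage_marginals (μ ν : ProbabilityMeasure X) :
    couplings μ ν = marginals ⁻¹' {(μ, ν)} := by
  ext ξ
  simp only [couplings, marginals, mem_ofPred_eq, mem_preimage, mem_singleton_iff, Prod.mk.injEq,
    ← ProbabilityMeasure.toMeasure_injective.eq_iff, ProbabilityMeasure.toMeasure_map]
  rfl

theorem couplings_nonempty (μ ν : ProbabilityMeasure X) : (couplings μ ν).Nonempty :=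
  ⟨μ.prod ν, by simp [couplings]⟩

theorem continuous_marginals [TopologicalSpace X] [SecondCountableTopology X] [BorelSpace X] :
    Continuous (marginals : ProbabilityMeasure (X × X) → _) :=
  (ProbabilityMeasure.continuous_map continuous_fst).prodMk
    (ProbabilityMeasure.continuous_map continuous_snd)

theorem isMeasurableClosedFamily_couplings [TopologicalSpace X] [CompactSpace X]
    [MetrizableSpace X] [BorelSpace X] {Ω : Type*} [MeasurableSpace Ω]
    {μ ν : Ω → ProbabilityMeasure X} (hμ : Measurable μ) (hν : Measurable ν) :
    IsMeasurableClosedFamily fun p => couplings (μ p) (ν p) := by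
  simp only [couplings_eq_preimage_marginals]
  exact .preimage_singleton continuous_marginals (hμ.prodMk hν)

variable {K : Type*} [MeasurableSpace K] {i : X → K}

theorem fst_map_prodMap (hi : Measurable i) (ρ : Measure (X × X)) :
    (ρ.map (Prod.map i i)).fst = ρ.fst.map i := by
  rw [Measure.fst, Measure.fst, Measure.map_map measurable_fst (hi.prodMap hi),
    Measure.map_map hi measurable_fst]
  rfl

theorem snd_map_prodMap (hi : Measurable i) (ρ : Measure (X × X)) :
    (ρ.map (Prod.map i i)).snd = ρ.snd.map i := by
  rw [Measure.snd, Measure.snd, Measure.map_map measurable_snd (hi.prodMap hi),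
    Measure.map_map hi measurable_snd]
  rfl

theorem map_prodMap_mem_couplings_iff (hi : MeasurableEmbedding i) {μ ν : ProbabilityMeasure X}
    {ξ : ProbabilityMeasure (X × X)} :
    ξ.map (hi.prodMap hi).measurable.aemeasurable ∈
      couplings (μ.map hi.measurable.aemeasurable) (ν.map hi.measurable.aemeasurable) ↔
    ξ ∈ couplings μ ν := by
  simp only [couplings, mem_ofPred_eq, ProbabilityMeasure.toMeasure_map,
    fst_map_prodMap hi.measurable, snd_map_prodMap hi.measurable, hi.map_injective.eq_iff]

theorem ae_mem_range_prodMap_of_mem_couplings (hi : MeasurableEmbedding i)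
    {μ ν : ProbabilityMeasure X} {ξ : ProbabilityMeasure (K × K)}
    (hξ : ξ ∈ couplings (μ.map hi.measurable.aemeasurable) (ν.map hi.measurable.aemeasurable)) :
    ∀ᵐ z ∂(ξ : Measure (K × K)), z ∈ range (Prod.map i i) := by
  have hrange (ρ : ProbabilityMeasure X) : ∀ᵐ x ∂((ρ : Measure X).map i), x ∈ range i :=
    ae_map_mem_range i hi.measurableSet_range ρ
  have hξ_fst : (ξ : Measure (K × K)).map Prod.fst = (μ : Measure X).map i := hξ.1
  have hξ_snd : (ξ : Measure (K × K)).map Prod.snd = (ν : Measure X).map i := hξ.2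
  have hfst : ∀ᵐ z ∂(ξ : Measure (K × K)), z.1 ∈ range i :=
    ae_of_ae_map (p := (· ∈ range i)) measurable_fst.aemeasurable (hξ_fst ▸ hrange μ)
  have hsnd : ∀ᵐ z ∂(ξ : Measure (K × K)), z.2 ∈ range i :=
    ae_of_ae_map (p := (· ∈ range i)) measurable_snd.aemeasurable (hξ_snd ▸ hrange ν)
  filter_upwards [hfst, hsnd] with z hz₁ hz₂
  rw [range_prodMap]
  exact ⟨hz₁, hz₂⟩

theorem image_map_prodMap_couplings (hi : MeasurableEmbedding i) (μ ν : ProbabilityMeasure X) :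
    (fun ξ => ξ.map (hi.prodMap hi).measurable.aemeasurable) '' couplings μ ν =
      couplings (μ.map hi.measurable.aemeasurable) (ν.map hi.measurable.aemeasurable) := by
  refine Subset.antisymm (image_subset_iff.2 fun ξ => (map_prodMap_mem_couplings_iff hi).2)
    fun ξ hξ => ?_
  obtain ⟨η, rfl⟩ := exists_map_eq_of_ae_mem_range (hi.prodMap hi) ξ
    (ae_mem_range_prodMap_of_mem_couplings hi hξ)
  exact ⟨η, (map_prodMap_mem_couplings_iff hi).1 hξ, rfl⟩

theorem iInf_couplings_map_eq_transportCost (hi : MeasurableEmbedding i) {c : X × X → ℝ≥0}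
    {J : ProbabilityMeasure (K × K) → ℝ≥0∞}
    (hJ : ∀ ξ, J (ξ.map (hi.prodMap hi).measurable.aemeasurable) = planCost c ξ)
    (μ ν : ProbabilityMeasure X) :
    ⨅ ξ ∈ couplings (μ.map hi.measurable.aemeasurable) (ν.map hi.measurable.aemeasurable), J ξ =
      transportCost c μ ν := by
  rw [← image_map_prodMap_couplings hi, iInf_image]
  simp only [hJ, transportCost]

variable [TopologicalSpace X] [TopologicalSpace K] [CompactSpace K] [MetrizableSpace K]
  [BorelSpace K] {c : X × X → ℝ≥0}

theorem exists_lowerSemicontinuous_map_eq_planCost (hi : IsEmbedding i)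
    (hi_meas : MeasurableEmbedding i) (hc : LowerSemicontinuous c) :
    ∃ J : ProbabilityMeasure (K × K) → ℝ≥0∞, LowerSemicontinuous J ∧
      ∀ ξ, J (ξ.map (hi_meas.prodMap hi_meas).measurable.aemeasurable) = planCost c ξ := by
  obtain ⟨c', hc', hcc'⟩ := exists_lowerSemicontinuous_extension (hi.prodMap hi).isInducing
    (ENNReal.continuous_coe.comp_lowerSemicontinuous hc ENNReal.coe_mono)
  refine ⟨_, lowerSemicontinuous_lintegral hc', fun ξ => ?_⟩
  simp [(hi_meas.prodMap hi_meas).lintegral_map, hcc', planCost]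

theorem measurable_transportCost_and_exists_measurable_optimal_of_isEmbedding (hi : IsEmbedding i)
    (hi_meas : MeasurableEmbedding i) {Ω : Type*} [MeasurableSpace Ω]
    {μ ν : Ω → ProbabilityMeasure X} (hμ : Measurable μ) (hν : Measurable ν)
    (hc : LowerSemicontinuous c) :
    (Measurable fun p => transportCost c (μ p) (ν p)) ∧
    ∃ ξ : Ω → ProbabilityMeasure (X × X), Measurable ξ ∧
      ∀ p, ξ p ∈ couplings (μ p) (ν p) ∧ planCost c (ξ p) = transportCost c (μ p) (ν p) := by
  obtain ⟨J, hJ, hJ_map⟩ := exists_lowerSemicontinuous_map_eq_planCost hi hi_meas hc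
  have hcost := iInf_couplings_map_eq_transportCost hi_meas hJ_map
  have hF := isMeasurableClosedFamily_couplings
    ((measurable_probabilityMeasure_map_iff hi_meas).2 hμ)
    ((measurable_probabilityMeasure_map_iff hi_meas).2 hν)
  refine ⟨by simpa only [hcost] using hF.measurable_iInf hJ, ?_⟩
  obtain ⟨s, hs_meas, hs⟩ := (hF.argminOn hJ).exists_measurable_selection fun p =>
    argminOn_nonempty hJ (hF.isClosed p) (couplings_nonempty _ _)
  choose ξ hξ hξs using fun p => (image_map_prodMap_couplings hi_meas (μ p) (ν p)).ge (hs p).1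
  refine ⟨ξ, ?_, fun p => ⟨hξ p, ?_⟩⟩
  · exact (measurable_probabilityMeasure_map_iff (hi_meas.prodMap hi_meas)).1
      (by simpa only [hξs] using hs_meas)
  · rw [← hJ_map, ← hcost, ← eq_iInf_of_mem_argminOn (hs p), ← hξs]

end Couplings

theorem propositionA1_general
    {X : Type*} [TopologicalSpace X] [MetrizableSpace X] [SecondCountableTopology X]
    [MeasurableSpace X] [BorelSpace X] [StandardBorelSpace X] {Ω : Type*} [MeasurableSpace Ω]
    {μ ν : Ω → ProbabilityMeasure X} (hμ : Measurable μ) (hν : Measurable ν)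
    {c : X × X → ℝ≥0} (hc : LowerSemicontinuous c) :
    (Measurable fun p => transportCost c (μ p) (ν p)) ∧
    ∃ ξ : Ω → ProbabilityMeasure (X × X), Measurable ξ ∧
      ∀ p, ξ p ∈ couplings (μ p) (ν p) ∧ planCost c (ξ p) = transportCost c (μ p) (ν p) := by
  obtain ⟨i, hi⟩ := exists_isEmbedding_hilbertCube X
  exact measurable_transportCost_and_exists_measurable_optimal_of_isEmbedding hi
    (hi.continuous.measurable.measurableEmbedding hi.injective) hμ hν hc

theorem propositionA1
    {X : Type*} [TopologicalSpace X] [PolishSpace X] [MeasurableSpace X] [BorelSpace X]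
    {Y : Type*} [MeasurableSpace Y]
    (μ : Y → ProbabilityMeasure X) (hμ : Measurable fun γ => (μ γ : Measure X))
    (c : X × X → ℝ≥0) (hc : LowerSemicontinuous c) :
    (Measurable fun p : Y × Y => transportCost c (μ p.1) (μ p.2)) ∧
    ∃ ξ : Y × Y → ProbabilityMeasure (X × X),
      (Measurable fun p => (ξ p : Measure (X × X))) ∧
      ∀ p : Y × Y, ξ p ∈ couplings (μ p.1) (μ p.2) ∧
        planCost c (ξ p) = transportCost c (μ p.1) (μ p.2) := by
  have hμ' : Measurable μ := hμ.subtype_mk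
  obtain ⟨hcost, ξ, hξ, hopt⟩ :=
    propositionA1_general (hμ'.comp measurable_fst) (hμ'.comp measurable_snd) hc
  exact ⟨hcost, ξ, measurable_subtype_coe.comp hξ, hopt⟩
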